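/- Let $p,m,n\ge 0$ be integers and let $$L(\lambda)=\begin{bmatrix} A(\lambda) & -B(\lambda)\\ C(\lambda) & D(\lambda)\end{bmatrix}=\begin{bmatrix}\lambda A_1-A_0 & B_0-\lambda B_1\\ \lambda C_1-C_0 & \lambda D_1-D_0\end{bmatrix}$$ be a linear system matrix, where $A_0,A_1\in\mathbb C^{p\times p}$, $B_0,B_1\in\mathbb C^{p\times n}$, $C_0,C_1\in\mathbb C^{m\times p}$, $D_0,D_1\in\mathbb C^{m\times n}$, and where $\lambda A_1-A_0$ is regular, i.e. $\det(\lambda A_1-A_0)\not\equiv 0$. If $L(\lambda)$ is strongly minimal, then $L(\lambda)$ is strongly irreducible. Here the terms have the following meaning. * *Eigenvalues.* Let $P(\lambda)$ be a polynomial matrix of degree at most $g$, considered as a matrix of grade $g$. A number $\lambda_0\in\mathbb C$ is a (finite) eigenvalue of $P$ if $\operatorname{rank}P(\lambda_0)$ is smaller than the normal rank of $P$ (its rank over $\mathbb C(\lambda)$); $\infty$ is an eigenvalue of $P$ if $0$ is an eigenvalue of the reversal $\lambda^{g}P(1/\lambda)$. * *Strong minimality.* Let $d$ be the degree of the polynomial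 matrix $L(\lambda)$ (the largest degree of its entries). $L(\lambda)$ is strongly minimal if $\begin{bmatrix}A(\lambda)&-B(\lambda)\end{bmatrix}$ and $\begin{bmatrix}A(\lambda)\\ C(\lambda)\end{bmatrix}$ have no finite or infinite eigenvalues, considered as polynomial matrices of grade $d$. * *Zeros.* A square rational matrix is regular at $\lambda_0\in\mathbb C\cup\{\infty\}$ if it is bounded at $\lambda_0$ and its value there is an invertible complex matrix. For an $m'\times n'$ rational matrix $R(\lambda)$ of normal rank $r$, there are rational matrices $M_\ell(\lambda)$, $M_r(\lambda)$ that are regular at $\lambda_0$ such that $M_\ell RM_r$ is the $m'\times n'$ quasi-diagonal matrix with diagonal entries $\pi^{d_1},\dots,\pi^{d_r}$ and zeros elsewhere, with integers $d_1\le\dots\le d_r$, where $\pi=\lambda-\lambda_0$ if $\lambda_0\in\mathbb C$ and $\pi=1/\lambda$ if $\lambda_0=\infty$ (the local Smith–McMillan form). The $d_i$ are uniquely determined. The point $\lambda_0$ is a zero of $R$ if some $d_i>0$. * *Strong irreducibility.* $L(\lambda)$ is strongly irreducible if the two polynomial matrices $$\begin{bmatrix}A(\lambda)&-B(\lambda)&0\\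 C(\lambda)&D(\lambda)&-I_m\end{bmatrix},\qquad \begin{bmatrix}A(\lambda)&-B(\lambda)\\ C(\lambda)&D(\lambda)\\ 0&I_n\end{bmatrix}$$ have no zeros in $\mathbb C\cup\{\infty\}$. -/

import Mathlib

open Polynomial

noncomputable section

namespace SystemMatrix

/-! ### Points of the Riemann sphere and the local Smith-McMillan form -/

/-- A rational function is bounded (has no pole) at a point of `ℂ ∪ {∞}`. -/
def BoundedAt (f : RatFunc ℂ) : OnePoint ℂ → Prop
  | OnePoint.infty => f.num.degree ≤ f.denom.degree
  | OnePoint.some z => f.denom.eval z ≠ 0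

/-- The value of a rational function at a point of `ℂ ∪ {∞}` where it is bounded
(recall that `f.denom` is monic). -/
def valueAt (f : RatFunc ℂ) : OnePoint ℂ → ℂ
  | OnePoint.infty => f.num.coeff f.denom.natDegree
  | OnePoint.some z => f.num.eval z / f.denom.eval z

/-- The basic factor at a point: `λ - λ₀` at a finite point `λ₀`, and `1 / λ` at infinity. -/
def basicFactor : OnePoint ℂ → RatFunc ℂ
  | OnePoint.infty => RatFunc.X⁻¹
  | OnePoint.some z => RatFunc.X - RatFunc.C z

/-- A square rational matrix is regular at a point (biproper, if the point is infinity) when it is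
bounded there and its value there is an invertible complex matrix. -/
def RegularAt {n : ℕ} (M : Matrix (Fin n) (Fin n) (RatFunc ℂ)) (z : OnePoint ℂ) : Prop :=
  (∀ i j, BoundedAt (M i j) z) ∧ IsUnit (M.map fun f => valueAt f z)

/-- The `m × n` quasi-diagonal matrix with `g ^ d₁, …, g ^ dᵣ` in the first `r` diagonal positions
and zeros elsewhere. -/
def quasiDiagonal (m n : ℕ) {r : ℕ} (g : RatFunc ℂ) (d : Fin r → ℤ) :
    Matrix (Fin m) (Fin n) (RatFunc ℂ) :=
  Matrix.of fun i j => if h : i.val = j.val ∧ i.val < r then g ^ d ⟨i.val, h.2⟩ else 0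

/-- `d₁ ≤ … ≤ dᵣ` are the structural indices of the rational matrix `R` (of normal rank `r`) at the
point `z`: the local Smith-McMillan form of `R` at `z` has the exponents `d`. -/
def IsStructuralIndices {m n : ℕ} (R : Matrix (Fin m) (Fin n) (RatFunc ℂ)) (z : OnePoint ℂ)
    (d : Fin R.rank → ℤ) : Prop :=
  Monotone d ∧
    ∃ (Ml : Matrix (Fin m) (Fin m) (RatFunc ℂ)) (Mr : Matrix (Fin n) (Fin n) (RatFunc ℂ)),
      RegularAt Ml z ∧ RegularAt Mr z ∧ Ml * R * Mr = quasiDiagonal m n (basicFactor z) d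

/-- `z` is a zero of the rational matrix `R`: some structural index at `z` is positive. -/
def IsZero {m n : ℕ} (R : Matrix (Fin m) (Fin n) (RatFunc ℂ)) (z : OnePoint ℂ) : Prop :=
  ∃ d : Fin R.rank → ℤ, IsStructuralIndices R z d ∧ ∃ i, 0 < d i

/-- A polynomial matrix, regarded as a rational matrix. -/
def toRational {ι κ : Type*} (P : Matrix ι κ ℂ[X]) : Matrix ι κ (RatFunc ℂ) :=
  P.map (algebraMap ℂ[X] (RatFunc ℂ))

/-! ### Eigenvalues of polynomial matrices of a given grade -/

/-- The degree of a polynomial matrix: the largest degree of an entry. -/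
def matDegree {ι κ : Type*} [Fintype ι] [Fintype κ] (P : Matrix ι κ ℂ[X]) : ℕ :=
  Finset.univ.sup fun i => Finset.univ.sup fun j => (P i j).natDegree

/-- `z : ℂ` is a finite eigenvalue: the rank of `P(z)` is below the normal rank of `P`. -/
def IsFiniteEigenvalue {ι κ : Type*} [Fintype κ] (P : Matrix ι κ ℂ[X]) (z : ℂ) : Prop :=
  (P.map (Polynomial.eval z)).rank < (toRational P).rank

/-- The reversal `λ ^ g P(1/λ)` of a polynomial matrix of grade `g`. -/
def reversal {ι κ : Type*} (g : ℕ) (P : Matrix ι κ ℂ[X]) : Matrix ι κ ℂ[X] :=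
  P.map (Polynomial.reflect g)

/-- `z` is an eigenvalue of `P`, considered as a polynomial matrix of grade `g`; infinity is one
if zero is an eigenvalue of the reversal. -/
def IsEigenvalue {ι κ : Type*} [Fintype κ] (g : ℕ) (P : Matrix ι κ ℂ[X]) : OnePoint ℂ → Prop
  | OnePoint.infty => IsFiniteEigenvalue (reversal g P) 0
  | OnePoint.some z => IsFiniteEigenvalue P z

/-! ### Polynomial system matrices -/

section

variable {p m n : ℕ}

/-- The polynomial system matrix `[T, -U; V, W]`. -/
def systemMatrix (T : Matrix (Fin p) (Fin p) ℂ[X]) (U : Matrix (Fin p) (Fin n) ℂ[X])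
    (V : Matrix (Fin m) (Fin p) ℂ[X]) (W : Matrix (Fin m) (Fin n) ℂ[X]) :
    Matrix (Fin p ⊕ Fin m) (Fin p ⊕ Fin n) ℂ[X] :=
  Matrix.fromBlocks T (-U) V W

/-- `[T, -U]` and `[T; V]` have no finite or infinite eigenvalues, considered as polynomial
matrices whose grade is the degree of the system matrix. -/
def StronglyMinimal (T : Matrix (Fin p) (Fin p) ℂ[X]) (U : Matrix (Fin p) (Fin n) ℂ[X])
    (V : Matrix (Fin m) (Fin p) ℂ[X]) (W : Matrix (Fin m) (Fin n) ℂ[X]) : Prop :=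
  (∀ z, ¬ IsEigenvalue (matDegree (systemMatrix T U V W)) (Matrix.fromCols T (-U)) z) ∧
    ∀ z, ¬ IsEigenvalue (matDegree (systemMatrix T U V W)) (Matrix.fromRows T V) z

/-- The bordered matrix `[T, -U, 0; V, W, -I]`. -/
def controlBordered (T : Matrix (Fin p) (Fin p) ℂ[X]) (U : Matrix (Fin p) (Fin n) ℂ[X])
    (V : Matrix (Fin m) (Fin p) ℂ[X]) (W : Matrix (Fin m) (Fin n) ℂ[X]) :
    Matrix (Fin p ⊕ Fin m) ((Fin p ⊕ Fin n) ⊕ Fin m) ℂ[X] :=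
  Matrix.fromCols (systemMatrix T U V W) (Matrix.fromRows 0 (-1))

/-- The bordered matrix `[T, -U; V, W; 0, I]`. -/
def observeBordered (T : Matrix (Fin p) (Fin p) ℂ[X]) (U : Matrix (Fin p) (Fin n) ℂ[X])
    (V : Matrix (Fin m) (Fin p) ℂ[X]) (W : Matrix (Fin m) (Fin n) ℂ[X]) :
    Matrix ((Fin p ⊕ Fin m) ⊕ Fin n) (Fin p ⊕ Fin n) ℂ[X] :=
  Matrix.fromRows (systemMatrix T U V W) (Matrix.fromCols 0 1)

/-- The order-preserving numbering of three consecutive blocks of indices. -/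
def blockEquiv (a b c : ℕ) : (Fin a ⊕ Fin b) ⊕ Fin c ≃ Fin (a + b + c) :=
  (Equiv.sumCongr finSumFinEquiv (Equiv.refl _)).trans finSumFinEquiv

/-- `[T, -U, 0; V, W, -I]` has no finite or infinite zeros. -/
def StronglyControllable (T : Matrix (Fin p) (Fin p) ℂ[X]) (U : Matrix (Fin p) (Fin n) ℂ[X])
    (V : Matrix (Fin m) (Fin p) ℂ[X]) (W : Matrix (Fin m) (Fin n) ℂ[X]) : Prop :=
  ∀ z, ¬ IsZero
    (Matrix.reindex finSumFinEquiv (blockEquiv p n m) (toRational (controlBordered T U V W))) z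

/-- `[T, -U; V, W; 0, I]` has no finite or infinite zeros. -/
def StronglyObservable (T : Matrix (Fin p) (Fin p) ℂ[X]) (U : Matrix (Fin p) (Fin n) ℂ[X])
    (V : Matrix (Fin m) (Fin p) ℂ[X]) (W : Matrix (Fin m) (Fin n) ℂ[X]) : Prop :=
  ∀ z, ¬ IsZero
    (Matrix.reindex (blockEquiv p m n) finSumFinEquiv (toRational (observeBordered T U V W))) z

/-- Strongly irreducible: strongly controllable and strongly observable. -/
def StronglyIrreducible (T : Matrix (Fin p) (Fin p) ℂ[X]) (U : Matrix (Fin p) (Fin n) ℂ[X])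
    (V : Matrix (Fin m) (Fin p) ℂ[X]) (W : Matrix (Fin m) (Fin n) ℂ[X]) : Prop :=
  StronglyControllable T U V W ∧ StronglyObservable T U V W

end

/-- The pencil `λ M₁ - M₀`. -/
def pencil {ι κ : Type*} (M₁ M₀ : Matrix ι κ ℂ) : Matrix ι κ ℂ[X] :=
  Matrix.of fun i j => X * C (M₁ i j) - C (M₀ i j)

end SystemMatrix

end

/-!
The argument is local. At a point `z` of the Riemann sphere, let `localRing z` be the ring of
rational functions bounded at `z`. A matrix over this ring is invertible as soon as its value at
`z` is invertible, so the transformations of a local Smith-McMillan form are invertible over the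
ring. Hence a rational matrix `R` with a right inverse bounded at `z` has no zero at `z`: carried
over to the Smith-McMillan form, the bounded inverse shows that each `π ^ dᵢ` has a bounded
inverse, whereas `π` vanishes at `z` (`not_isZero_of_mul_eq_one`). The same holds with a left
inverse.

Finite points and infinity are treated together by reading a polynomial of degree at most `N` as a
section of `𝒪(N)`. Its leading value at `z` is its value if `z` is finite and its `N`-th
coefficient if `z = ∞`; thus `z` is not an eigenvalue of a polynomial matrix of grade `g` exactly
when the matrix of leading values has the normal rank. Dividing by the `g`-th power of a section
`s` of `𝒪(1)` that does not vanish at `z` (`s = 1` at finite points, `s = λ` at infinity) turns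
matrices of grade `g` into matrices over `localRing z`.

If `G = [T, -U]` has no eigenvalue at `z`, then `G / s ^ g` has a right inverse `H` bounded at `z`
(`exists_mul_eq_one_of_le_rank`), and with `Q = [V, W]` and `ε = ±1`
`[G, 0; Q, ε] * [H / s ^ g, 0; -ε (Q / s ^ g) H, ε] = 1`,
where all entries of the second factor are bounded at `z`, since `Q` has degree at most `g` too.
So the first bordered matrix has no zero. The second one is treated by transposition. The argument
is valid for polynomial system matrices of any degree with `det T ≠ 0`.
-/

open Polynomial

namespace SystemMatrix

/-! ### The local ring at a point of the Riemann sphere -/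

/-- The leading value at a point of the Riemann sphere of a polynomial of degree at most `N`, read
as a section of `𝒪(N)`: its value at a finite point, and its `N`-th coefficient at infinity. -/
noncomputable def leadingValue : OnePoint ℂ → ℕ → ℂ[X] →+ ℂ
  | OnePoint.infty, N => (Polynomial.lcoeff ℂ N).toAddMonoidHom
  | OnePoint.some z, _ => (Polynomial.evalRingHom z).toAddMonoidHom

@[simp] theorem leadingValue_infty (N : ℕ) (f : ℂ[X]) :
    leadingValue OnePoint.infty N f = f.coeff N := rfl

@[simp] theorem leadingValue_some (z : ℂ) (N : ℕ) (f : ℂ[X]) :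
    leadingValue (OnePoint.some z) N f = f.eval z := rfl

theorem leadingValue_mul (z : OnePoint ℂ) {M N : ℕ} {f g : ℂ[X]} (hf : f.natDegree ≤ M)
    (hg : g.natDegree ≤ N) :
    leadingValue z (M + N) (f * g) = leadingValue z M f * leadingValue z N g :=
  match z with
  | OnePoint.infty => coeff_mul_add_eq_of_natDegree_le hf hg
  | OnePoint.some _ => eval_mul

/-- The local ring at `z`, encoded as the graph of the evaluation at `z`: the pairs of a rational
function bounded at `z` and its value there. The function is a quotient of two polynomials of
degree at most some `N` whose denominator has a nonzero leading value at `z`. -/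
def localRing (z : OnePoint ℂ) : Subring (RatFunc ℂ × ℂ) where
  carrier := {x | ∃ (N : ℕ) (f g : ℂ[X]), f.natDegree ≤ N ∧ g.natDegree ≤ N ∧
    leadingValue z N g ≠ 0 ∧ x.1 * algebraMap _ _ g = algebraMap _ _ f ∧
    leadingValue z N f = x.2 * leadingValue z N g}
  mul_mem' := by
    rintro x y ⟨M, f, g, hf, hg, hg0, hx, hv⟩ ⟨N, f', g', hf', hg', hg0', hy, hv'⟩
    refine ⟨M + N, f * f', g * g', natDegree_mul_le_of_le hf hf', natDegree_mul_le_of_le hg hg',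
      ?_, ?_, ?_⟩
    · rw [leadingValue_mul z hg hg']; exact mul_ne_zero hg0 hg0'
    · rw [map_mul, map_mul, ← hx, ← hy, Prod.fst_mul]; ring
    · rw [leadingValue_mul z hg hg', leadingValue_mul z hf hf', hv, hv', Prod.snd_mul]; ring
  one_mem' := ⟨0, 1, 1, by simp, by simp, by cases z <;> simp, by simp, by simp⟩
  add_mem' := by
    rintro x y ⟨M, f, g, hf, hg, hg0, hx, hv⟩ ⟨N, f', g', hf', hg', hg0', hy, hv'⟩
    refine ⟨M + N, f * g' + g * f', g * g', natDegree_add_le_of_degree_le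
      (natDegree_mul_le_of_le hf hg') (natDegree_mul_le_of_le hg hf'),
      natDegree_mul_le_of_le hg hg', ?_, ?_, ?_⟩
    · rw [leadingValue_mul z hg hg']; exact mul_ne_zero hg0 hg0'
    · rw [map_add, map_mul, map_mul, map_mul, ← hx, ← hy, Prod.fst_add]; ring
    · rw [leadingValue_mul z hg hg', map_add, leadingValue_mul z hf hg', leadingValue_mul z hg hf',
        hv, hv', Prod.snd_add]
      ring
  zero_mem' := ⟨0, 0, 1, by simp, by simp, by cases z <;> simp, by simp, by simp⟩
  neg_mem' := by
    rintro x ⟨M, f, g, hf, hg, hg0, hx, hv⟩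
    exact ⟨M, -f, g, by rwa [natDegree_neg], hg, hg0, by simp [← hx], by simp [hv]⟩

/-- The rational function underlying an element of the local ring. -/
noncomputable def localFun (z : OnePoint ℂ) : localRing z →+* RatFunc ℂ :=
  (RingHom.fst _ _).comp (localRing z).subtype

/-- The value at `z` of an element of the local ring. -/
noncomputable def localValue (z : OnePoint ℂ) : localRing z →+* ℂ :=
  (RingHom.snd _ _).comp (localRing z).subtype

theorem mem_localRing_of_boundedAt {f : RatFunc ℂ} {z : OnePoint ℂ} (h : BoundedAt f z) :
    (f, valueAt f z) ∈ localRing z := by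
  have hf : f * algebraMap _ _ f.denom = algebraMap _ _ f.num := by
    conv_lhs => enter [1]; rw [← RatFunc.num_div_denom f]
    exact div_mul_cancel₀ _ (RatFunc.algebraMap_ne_zero f.denom_ne_zero)
  match z, h with
  | OnePoint.infty, h =>
    refine ⟨f.denom.natDegree, f.num, f.denom, natDegree_le_natDegree h, le_rfl, ?_, hf, ?_⟩
    · simp [f.monic_denom.leadingCoeff]
    · simp [f.monic_denom.leadingCoeff, valueAt]
  | OnePoint.some z, h =>
    refine ⟨max f.num.natDegree f.denom.natDegree, f.num, f.denom, le_max_left _ _,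
      le_max_right _ _, h, hf, ?_⟩
    exact (div_mul_cancel₀ _ h).symm

theorem localFun_injective (z : OnePoint ℂ) : Function.Injective (localFun z) := by
  rw [injective_iff_map_eq_zero]
  rintro ⟨⟨f, c⟩, N, a, b, -, -, hb, hab, hc⟩ (rfl : f = 0)
  have ha : a = 0 := by
    refine RatFunc.algebraMap_injective ℂ ?_
    rw [← hab, map_zero]; exact zero_mul _
  rw [ha, map_zero] at hc
  have : c = 0 := (mul_eq_zero.mp hc.symm).resolve_right hb
  subst this
  rfl

theorem isUnit_of_localValue_ne_zero {z : OnePoint ℂ} {x : localRing z}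
    (h : localValue z x ≠ 0) : IsUnit x := by
  obtain ⟨⟨f, c⟩, N, a, b, ha, hb, hb0, hab, hc⟩ := x
  replace h : c ≠ 0 := h
  dsimp only at hab hc
  have ha0 : leadingValue z N a ≠ 0 := by rw [hc]; exact mul_ne_zero h hb0
  have hf : f ≠ 0 := by
    rintro rfl
    rw [zero_mul, eq_comm, map_eq_zero_iff _ (RatFunc.algebraMap_injective ℂ)] at hab
    exact ha0 (by rw [hab, map_zero])
  refine .of_mul_eq_one ⟨(f⁻¹, c⁻¹), N, b, a, hb, ha, ha0, ?_, ?_⟩ ?_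
  · dsimp only; rw [← hab, inv_mul_cancel_left₀ hf]
  · dsimp only; rw [hc, inv_mul_cancel_left₀ h]
  · exact Subtype.ext (Prod.ext (mul_inv_cancel₀ hf) (mul_inv_cancel₀ h))

/-- The local ring contains the constants. -/
noncomputable def localConst (z : OnePoint ℂ) : ℂ →+* localRing z :=
  (RingHom.prod RatFunc.C (RingHom.id ℂ)).codRestrict (localRing z) fun c =>
    ⟨0, C c, 1, by simp, by simp, by cases z <;> simp,
      by simp, by cases z <;> simp⟩

@[simp] theorem localValue_localConst (z : OnePoint ℂ) (c : ℂ) :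
    localValue z (localConst z c) = c := rfl

/-- A section of `𝒪(1)` that does not vanish at `z`. -/
noncomputable def unitSection : OnePoint ℂ → ℂ[X]
  | OnePoint.infty => X
  | OnePoint.some _ => 1

theorem unitSection_ne_zero (z : OnePoint ℂ) : unitSection z ≠ 0 :=
  match z with
  | OnePoint.infty => X_ne_zero
  | OnePoint.some _ => one_ne_zero

theorem exists_localFun_eq_div (z : OnePoint ℂ) {N : ℕ} {f : ℂ[X]} (hf : f.natDegree ≤ N) :
    ∃ x : localRing z, localFun z x = algebraMap _ _ f / algebraMap _ _ (unitSection z ^ N) ∧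
      localValue z x = leadingValue z N f := by
  refine ⟨⟨(_, _), N, f, unitSection z ^ N, hf, ?_, ?_, div_mul_cancel₀ _
    (RatFunc.algebraMap_ne_zero (pow_ne_zero _ (unitSection_ne_zero z))), ?_⟩, rfl, rfl⟩ <;>
  cases z <;> simp [unitSection]

/-- The basic factor belongs to the local ring and vanishes at the point. -/
theorem exists_localFun_eq_basicFactor (z : OnePoint ℂ) :
    ∃ x : localRing z, localFun z x = basicFactor z ∧ localValue z x = 0 := by
  cases z with
  | infty =>
    obtain ⟨x, hx, hv⟩ := exists_localFun_eq_div OnePoint.infty (N := 1) (f := 1) (by simp)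
    exact ⟨x, by simp [hx, unitSection, basicFactor], by simp [hv, coeff_one]⟩
  | coe z =>
    obtain ⟨x, hx, hv⟩ := exists_localFun_eq_div (OnePoint.some z) (N := 1) (f := X - C z)
      (natDegree_X_sub_C z).le
    refine ⟨x, ?_, by simpa using hv⟩
    rw [hx]
    simp [unitSection, basicFactor]

/-! ### Matrices over the local ring -/

theorem isUnit_of_isUnit_map_localValue {ι : Type*} [Fintype ι] [DecidableEq ι] {z : OnePoint ℂ}
    {M : Matrix ι ι (localRing z)} (h : IsUnit (M.map (localValue z))) : IsUnit M := by
  rw [Matrix.isUnit_iff_isUnit_det] at h ⊢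
  refine isUnit_of_localValue_ne_zero ?_
  rw [RingHom.map_det]
  exact h.ne_zero

theorem exists_mul_eq_one_of_le_rank {p : ℕ} {κ : Type*} [Fintype κ] {z : OnePoint ℂ}
    {G : Matrix (Fin p) κ (localRing z)} (h : p ≤ (G.map (localValue z)).rank) :
    ∃ H : Matrix κ (Fin p) (localRing z), G * H = 1 := by
  have hsurj : Function.Surjective (G.map (localValue z)).mulVec := by
    have : (G.map (localValue z)).mulVecLin.range = ⊤ := by
      refine Submodule.eq_top_of_finrank_eq (le_antisymm (Submodule.finrank_le _) ?_)
      simpa [Matrix.rank] using h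
    exact LinearMap.range_eq_top.mp this
  obtain ⟨K, hK⟩ := Matrix.mulVec_surjective_iff_exists_right_inverse.mp hsurj
  -- A constant right inverse of the value of `G` inverts `G` up to a matrix of value `1`.
  have hu : IsUnit (G * K.map (localConst z)) := by
    refine isUnit_of_isUnit_map_localValue ?_
    have : (K.map (localConst z)).map (localValue z) = K := rfl
    rw [Matrix.map_mul, this, hK]
    exact isUnit_one
  obtain ⟨N, hN⟩ := hu.exists_right_inv
  exact ⟨K.map (localConst z) * N, by rw [← Matrix.mul_assoc, hN]⟩

theorem exists_inverse_of_regularAt {n : ℕ} {z : OnePoint ℂ}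
    {M : Matrix (Fin n) (Fin n) (RatFunc ℂ)} (h : RegularAt M z) :
    ∃ N : Matrix (Fin n) (Fin n) (localRing z),
      M * N.map (localFun z) = 1 ∧ N.map (localFun z) * M = 1 := by
  let M' : Matrix (Fin n) (Fin n) (localRing z) :=
    Matrix.of fun i j => ⟨(M i j, valueAt (M i j) z), mem_localRing_of_boundedAt (h.1 i j)⟩
  have hM : M'.map (localFun z) = M := rfl
  obtain ⟨u, hu⟩ := isUnit_of_isUnit_map_localValue (M := M') h.2
  refine ⟨u.inv, ?_, ?_⟩
  · rw [← hM, ← Matrix.map_mul, ← hu, u.val_inv, Matrix.map_one _ (map_zero _) (map_one _)]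
  · rw [← hM, ← Matrix.map_mul, ← hu, u.inv_val, Matrix.map_one _ (map_zero _) (map_one _)]

/-- A positive power of the basic factor has no inverse in the local ring. -/
theorem basicFactor_zpow_mul_localFun_ne_one {z : OnePoint ℂ} {k : ℤ} (hk : 0 < k)
    (y : localRing z) : basicFactor z ^ k * localFun z y ≠ 1 := by
  intro h
  obtain ⟨x, hx, hx0⟩ := exists_localFun_eq_basicFactor z
  lift k to ℕ using hk.le
  rw [zpow_natCast, ← hx, ← map_pow, ← map_mul, ← map_one (localFun z)] at h
  have := congrArg (localValue z) (localFun_injective z h)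
  rw [map_mul, map_pow, hx0, zero_pow (by omega), zero_mul, map_one] at this
  exact zero_ne_one this

/-- A rational matrix with a right inverse that is bounded at `z` has no zero at `z`. -/
theorem not_isZero_of_mul_eq_one {m n : ℕ} {R : Matrix (Fin m) (Fin n) (RatFunc ℂ)}
    {z : OnePoint ℂ} {Y : Matrix (Fin n) (Fin m) (localRing z)}
    (h : R * Y.map (localFun z) = 1) : ¬ IsZero R z := by
  rintro ⟨d, ⟨-, Ml, Mr, hl, hr, hq⟩, i, hi⟩
  obtain ⟨Nl, hNl, -⟩ := exists_inverse_of_regularAt hl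
  obtain ⟨Nr, hNr, -⟩ := exists_inverse_of_regularAt hr
  have key : quasiDiagonal m n (basicFactor z) d * (Nr * Y * Nl).map (localFun z) = 1 := by
    rw [← hq, Matrix.map_mul, Matrix.map_mul]
    calc _ = Ml * (R * (Mr * Nr.map (localFun z)) * Y.map (localFun z)) * Nl.map (localFun z) := by
          simp only [Matrix.mul_assoc]
      _ = 1 := by rw [hNr, Matrix.mul_one, h, Matrix.mul_one, hNl]
  have him : i.val < m := i.2.trans_le R.rank_le_height
  have hin : i.val < n := i.2.trans_le R.rank_le_width
  have := congrFun (congrFun key ⟨i, him⟩) ⟨i, him⟩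
  rw [Matrix.mul_apply, Finset.sum_eq_single ⟨i, hin⟩, Matrix.one_apply_eq, quasiDiagonal,
    Matrix.of_apply, dif_pos ⟨rfl, i.2⟩] at this
  · exact basicFactor_zpow_mul_localFun_ne_one hi _ this
  · intro k _ hk
    rw [quasiDiagonal, Matrix.of_apply, dif_neg, zero_mul]
    exact fun hik => hk (Fin.ext hik.1.symm)
  · simp

/-- A rational matrix with a left inverse that is bounded at `z` has no zero at `z`. -/
theorem not_isZero_of_mul_eq_one' {m n : ℕ} {R : Matrix (Fin m) (Fin n) (RatFunc ℂ)}
    {z : OnePoint ℂ} {Y : Matrix (Fin n) (Fin m) (localRing z)}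
    (h : Y.map (localFun z) * R = 1) : ¬ IsZero R z := by
  rintro ⟨d, ⟨-, Ml, Mr, hl, hr, hq⟩, i, hi⟩
  obtain ⟨Nl, -, hNl⟩ := exists_inverse_of_regularAt hl
  obtain ⟨Nr, -, hNr⟩ := exists_inverse_of_regularAt hr
  have key : (Nr * Y * Nl).map (localFun z) * quasiDiagonal m n (basicFactor z) d = 1 := by
    rw [← hq, Matrix.map_mul, Matrix.map_mul]
    calc _ = Nr.map (localFun z) * (Y.map (localFun z) * (Nl.map (localFun z) * Ml) * R) * Mr := by
          simp only [Matrix.mul_assoc]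
      _ = 1 := by rw [hNl, Matrix.mul_one, h, Matrix.mul_one, hNr]
  have him : i.val < m := i.2.trans_le R.rank_le_height
  have hin : i.val < n := i.2.trans_le R.rank_le_width
  have := congrFun (congrFun key ⟨i, hin⟩) ⟨i, hin⟩
  rw [Matrix.mul_apply, Finset.sum_eq_single ⟨i, him⟩, Matrix.one_apply_eq, quasiDiagonal,
    Matrix.of_apply, dif_pos ⟨rfl, i.2⟩, mul_comm] at this
  · exact basicFactor_zpow_mul_localFun_ne_one hi _ this
  · intro k _ hk
    rw [quasiDiagonal, Matrix.of_apply, dif_neg, mul_zero]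
    exact fun hik => hk (Fin.ext hik.1)
  · simp

/-! ### Eigenvalues and leading values -/

theorem le_rank_toRational {p : ℕ} {κ : Type*} [Fintype κ] (P : Matrix (Fin p) κ ℂ[X])
    (e : Fin p → κ) (h : (P.submatrix id e).det ≠ 0) : p ≤ (toRational P).rank := by
  have hdet : IsUnit ((toRational P).submatrix id e) := by
    rw [Matrix.isUnit_iff_isUnit_det, isUnit_iff_ne_zero]
    have : ((toRational P).submatrix id e).det =
        algebraMap ℂ[X] (RatFunc ℂ) (P.submatrix id e).det :=
      (RingHom.map_det (algebraMap ℂ[X] (RatFunc ℂ)) _).symm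
    rw [this]
    exact RatFunc.algebraMap_ne_zero h
  calc p = ((toRational P).submatrix id e).rank := by
        rw [Matrix.rank_of_isUnit _ hdet, Fintype.card_fin]
    _ ≤ _ := Matrix.rank_submatrix_le _ _ _

theorem det_reversal_ne_zero {p g : ℕ} {T : Matrix (Fin p) (Fin p) ℂ[X]} (hT : T.det ≠ 0)
    (hg : ∀ i j, (T i j).natDegree ≤ g) : (reversal g T).det ≠ 0 := by
  -- At `1/x`, the reversal is `T x` up to the factor `x ^ g`; so evaluate at some `1/x` with
  -- `x ≠ 0` and `det (T x) ≠ 0`.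
  obtain ⟨x, hx⟩ : ∃ x, (X * T.det).eval x ≠ 0 := by
    by_contra! h
    exact mul_ne_zero X_ne_zero hT (Polynomial.funext fun r => by rw [h r, eval_zero])
  rw [eval_mul, eval_X, mul_ne_zero_iff] at hx
  obtain ⟨hx0, hx⟩ := hx
  have hrev : x ^ g • (reversal g T).map (eval x⁻¹) = T.map (eval x) := by
    ext i j
    let _ := invertibleOfNonzero hx0
    have := eval₂_reflect_mul_pow (RingHom.id ℂ) x g (T i j) (hg i j)
    rw [invOf_eq_inv] at this
    rw [mul_comm] at this
    exact this
  intro h0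
  apply hx
  have h1 : T.det.eval x = (T.map (eval x)).det := RingHom.map_det (evalRingHom x) T
  have h2 : (reversal g T).det.eval x⁻¹ = ((reversal g T).map (eval x⁻¹)).det :=
    RingHom.map_det (evalRingHom x⁻¹) _
  rw [h1, ← hrev, Matrix.det_smul, ← h2, h0, eval_zero, mul_zero]

/-- If `z` is not an eigenvalue of a matrix of grade `g` whose normal rank is its number of rows,
then the matrix of leading values at `z` has full row rank. -/
theorem le_rank_leadingValue {p g : ℕ} {κ : Type*} [Fintype κ] {P : Matrix (Fin p) κ ℂ[X]}
    {e : Fin p → κ} (h : (P.submatrix id e).det ≠ 0) (hg : ∀ i j, (P i j).natDegree ≤ g)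
    {z : OnePoint ℂ} (hz : ¬ IsEigenvalue g P z) : p ≤ (P.map (leadingValue z g)).rank := by
  cases z with
  | infty =>
    have hmap : P.map (leadingValue OnePoint.infty g) = (reversal g P).map (eval 0) := by
      ext i j
      simp [reversal, ← coeff_zero_eq_eval_zero, coeff_reflect]
    rw [hmap]
    exact (le_rank_toRational (reversal g P) e
      (det_reversal_ne_zero h fun i j => hg i (e j))).trans (not_lt.mp hz)
  | coe z => exact (le_rank_toRational P e h).trans (not_lt.mp hz)

theorem isEigenvalue_transpose {ι κ : Type*} [Fintype ι] [Fintype κ] (g : ℕ)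
    (P : Matrix ι κ ℂ[X]) (z : OnePoint ℂ) :
    IsEigenvalue g P.transpose z ↔ IsEigenvalue g P z := by
  have key (P : Matrix ι κ ℂ[X]) (x : ℂ) :
      IsFiniteEigenvalue P.transpose x ↔ IsFiniteEigenvalue P x := by
    unfold IsFiniteEigenvalue toRational
    rw [Matrix.transpose_map, Matrix.transpose_map, Matrix.rank_transpose, Matrix.rank_transpose]
  cases z with
  | infty => exact key (reversal g P) 0
  | coe z => exact key P z

theorem natDegree_le_matDegree {ι κ : Type*} [Fintype ι] [Fintype κ] (P : Matrix ι κ ℂ[X])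
    (i : ι) (j : κ) : (P i j).natDegree ≤ matDegree P :=
  (Finset.le_sup (f := fun j => (P i j).natDegree) (Finset.mem_univ j)).trans
    (Finset.le_sup (f := fun i => Finset.univ.sup fun j => (P i j).natDegree) (Finset.mem_univ i))

/-! ### Bounded inverses of the bordered matrices -/

/-- A polynomial matrix of grade `g`, divided by the `g`-th power of a section of `𝒪(1)` not
vanishing at `z`, is a matrix over the local ring whose value is the matrix of leading values. -/
theorem exists_map_localFun_eq_smul {ι κ : Type*} (z : OnePoint ℂ) {g : ℕ} {P : Matrix ι κ ℂ[X]}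
    (hg : ∀ i j, (P i j).natDegree ≤ g) :
    ∃ M : Matrix ι κ (localRing z),
      M.map (localFun z) = (algebraMap _ (RatFunc ℂ) (unitSection z ^ g))⁻¹ • toRational P ∧
      M.map (localValue z) = P.map (leadingValue z g) := by
  choose M hM hv using fun i j => exists_localFun_eq_div z (hg i j)
  refine ⟨Matrix.of M, ?_, ?_⟩
  · ext i j
    simp [hM, toRational, div_eq_inv_mul]
  · ext i j
    simp [hv]

/-- If `G` has full normal row rank and no eigenvalue at `z`, then bordering `[G; Q]` by a column
`[0; ε]`, `ε = ±1`, gives a matrix with a right inverse bounded at `z`. -/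
theorem exists_mul_eq_one_of_not_isEigenvalue {p g : ℕ} {κ μ : Type*} [Fintype κ]
    [Fintype μ] [DecidableEq μ] {G : Matrix (Fin p) κ ℂ[X]} {Q : Matrix μ κ ℂ[X]}
    {e : Fin p → κ} (hdet : (G.submatrix id e).det ≠ 0) (hG : ∀ i j, (G i j).natDegree ≤ g)
    (hQ : ∀ i j, (Q i j).natDegree ≤ g) {z : OnePoint ℂ} (hz : ¬ IsEigenvalue g G z)
    (ε : ℤˣ) :
    ∃ Y : Matrix (κ ⊕ μ) (Fin p ⊕ μ) (localRing z),
      toRational (Matrix.fromBlocks G 0 Q ((ε : ℤ) • (1 : Matrix μ μ ℂ[X]))) *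
        Y.map (localFun z) = 1 := by
  obtain ⟨G', hG', hGv⟩ := exists_map_localFun_eq_smul z hG
  obtain ⟨Q', hQ', -⟩ := exists_map_localFun_eq_smul z hQ
  obtain ⟨s, hs, -⟩ := exists_localFun_eq_div z (N := g) (f := 1) (by simp)
  rw [map_one, one_div] at hs
  obtain ⟨H, hH⟩ := exists_mul_eq_one_of_le_rank (G := G')
    (hGv ▸ le_rank_leadingValue hdet hG hz)
  refine ⟨Matrix.fromBlocks (s • H) 0 (-((ε : ℤ) • (Q' * H)))
    ((ε : ℤ) • (1 : Matrix μ μ (localRing z))), ?_⟩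
  have hε : (ε : ℤ) * ε = 1 := by
    rw [← Units.val_mul, Int.units_mul_self, Units.val_one]
  have hH1 : G'.map (localFun z) * H.map (localFun z) = 1 := by
    rw [← Matrix.map_mul, hH, Matrix.map_one _ (map_zero _) (map_one _)]
  have hsH : (s • H).map (localFun z) = localFun z s • H.map (localFun z) := by
    ext; simp
  have hQH : (-((ε : ℤ) • (Q' * H))).map (localFun z) =
      -((ε : ℤ) • (Q'.map (localFun z) * H.map (localFun z))) := by
    rw [← Matrix.map_mul, ← Matrix.map_smul _ _ (fun a => map_zsmul (localFun z) _ a)]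
    ext; simp
  have h1 : ((ε : ℤ) • (1 : Matrix μ μ (localRing z))).map (localFun z) =
      (ε : ℤ) • (1 : Matrix μ μ (RatFunc ℂ)) := by
    rw [Matrix.map_smul _ _ (fun a => map_zsmul (localFun z) _ a),
      Matrix.map_one _ (map_zero _) (map_one _)]
  have h1' : toRational ((ε : ℤ) • (1 : Matrix μ μ ℂ[X])) =
      (ε : ℤ) • (1 : Matrix μ μ (RatFunc ℂ)) := by
    rw [toRational, Matrix.map_smul _ _ (fun a => map_zsmul (algebraMap ℂ[X] (RatFunc ℂ)) _ a),
      Matrix.map_one _ (map_zero _) (map_one _)]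
  have hblocks : toRational (Matrix.fromBlocks G 0 Q ((ε : ℤ) • (1 : Matrix μ μ ℂ[X]))) =
      Matrix.fromBlocks (toRational G) 0 (toRational Q)
        ((ε : ℤ) • (1 : Matrix μ μ (RatFunc ℂ))) := by
    rw [← h1', toRational, Matrix.fromBlocks_map, Matrix.map_zero _ (map_zero _)]
    rfl
  rw [hblocks, Matrix.fromBlocks_map, hsH, hQH, h1, Matrix.map_zero _ (map_zero _),
    Matrix.fromBlocks_multiply, ← Matrix.fromBlocks_one]
  congr 1
  · rw [Matrix.zero_mul, add_zero, Matrix.mul_smul, ← Matrix.smul_mul, hs, ← hG', hH1]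
  · simp
  · rw [Matrix.mul_smul, ← Matrix.smul_mul, hs, ← hQ', Matrix.mul_neg, Matrix.smul_mul,
      Matrix.mul_smul, smul_smul, hε, one_smul, Matrix.one_mul, add_neg_cancel]
  · rw [Matrix.mul_zero, zero_add, smul_mul_smul_comm, hε, one_smul, Matrix.one_mul]

section

variable {p m n : ℕ} {T : Matrix (Fin p) (Fin p) ℂ[X]} {U : Matrix (Fin p) (Fin n) ℂ[X]}
  {V : Matrix (Fin m) (Fin p) ℂ[X]} {W : Matrix (Fin m) (Fin n) ℂ[X]}

theorem stronglyControllable_of_not_isEigenvalue (hT : T.det ≠ 0)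
    (h : ∀ z, ¬ IsEigenvalue (matDegree (systemMatrix T U V W)) (Matrix.fromCols T (-U)) z) :
    StronglyControllable T U V W := by
  intro z
  have hdeg := natDegree_le_matDegree (systemMatrix T U V W)
  obtain ⟨Y, hY⟩ := exists_mul_eq_one_of_not_isEigenvalue (G := Matrix.fromCols T (-U))
    (Q := Matrix.fromCols V W) (e := Sum.inl) hT
    (by rintro i (j | j); exacts [hdeg (.inl i) (.inl j), hdeg (.inl i) (.inr j)])
    (by rintro i (j | j); exacts [hdeg (.inr i) (.inl j), hdeg (.inr i) (.inr j)]) (h z) (-1)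
  have hK : controlBordered T U V W = Matrix.fromBlocks (Matrix.fromCols T (-U)) 0
      (Matrix.fromCols V W) (((-1 : ℤˣ) : ℤ) • 1) := by
    ext (i | i) ((j | j) | j) <;> simp [controlBordered, systemMatrix]
  rw [← hK] at hY
  refine not_isZero_of_mul_eq_one (Y := Matrix.reindex (blockEquiv p n m) finSumFinEquiv Y) ?_
  rw [Matrix.reindex_apply, Matrix.reindex_apply, ← Matrix.submatrix_map,
    Matrix.submatrix_mul_equiv, hY, Matrix.submatrix_one_equiv]

theorem stronglyObservable_of_not_isEigenvalue (hT : T.det ≠ 0)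
    (h : ∀ z, ¬ IsEigenvalue (matDegree (systemMatrix T U V W)) (Matrix.fromRows T V) z) :
    StronglyObservable T U V W := by
  intro z
  have hdeg := natDegree_le_matDegree (systemMatrix T U V W)
  obtain ⟨Y, hY⟩ := exists_mul_eq_one_of_not_isEigenvalue (G := (Matrix.fromRows T V).transpose)
    (Q := (Matrix.fromRows (-U) W).transpose) (e := Sum.inl)
    (by rw [← Matrix.det_transpose] at hT; exact hT)
    (by rintro i (j | j); exacts [hdeg (.inl j) (.inl i), hdeg (.inr j) (.inl i)])
    (by rintro i (j | j); exacts [hdeg (.inl j) (.inr i), hdeg (.inr j) (.inr i)])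
    (mt (isEigenvalue_transpose _ _ z).mp (h z)) 1
  have hK : (observeBordered T U V W).transpose = Matrix.fromBlocks
      (Matrix.fromRows T V).transpose 0 (Matrix.fromRows (-U) W).transpose
      (((1 : ℤˣ) : ℤ) • 1) := by
    ext (i | i) ((j | j) | j) <;>
      simp [observeBordered, systemMatrix, Matrix.one_apply, eq_comm]
  rw [← hK, toRational, Matrix.transpose_map] at hY
  replace hY := congrArg Matrix.transpose hY
  rw [Matrix.transpose_mul, Matrix.transpose_transpose, Matrix.transpose_one,
    ← Matrix.transpose_map] at hY
  refine not_isZero_of_mul_eq_one'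
    (Y := Matrix.reindex finSumFinEquiv (blockEquiv p m n) Y.transpose) ?_
  rw [Matrix.reindex_apply, Matrix.reindex_apply, ← Matrix.submatrix_map,
    Matrix.submatrix_mul_equiv, toRational, hY, Matrix.submatrix_one_equiv]

end

end SystemMatrix

theorem mainTheorem4 {p m n : ℕ}
    (A₁ A₀ : Matrix (Fin p) (Fin p) ℂ) (B₁ B₀ : Matrix (Fin p) (Fin n) ℂ)
    (C₁ C₀ : Matrix (Fin m) (Fin p) ℂ) (D₁ D₀ : Matrix (Fin m) (Fin n) ℂ)
    (hA : (SystemMatrix.pencil A₁ A₀).det ≠ 0)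
    (hmin : SystemMatrix.StronglyMinimal (SystemMatrix.pencil A₁ A₀) (SystemMatrix.pencil B₁ B₀)
      (SystemMatrix.pencil C₁ C₀) (SystemMatrix.pencil D₁ D₀)) :
    SystemMatrix.StronglyIrreducible (SystemMatrix.pencil A₁ A₀) (SystemMatrix.pencil B₁ B₀)
      (SystemMatrix.pencil C₁ C₀) (SystemMatrix.pencil D₁ D₀) := by
  exact ⟨SystemMatrix.stronglyControllable_of_not_isEigenvalue hA hmin.1,
    SystemMatrix.stronglyObservable_of_not_isEigenvalue hA hmin.2⟩
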